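/- Let $q \ge 1$ be an integer and let $\mathcal{A}$ be an Azumaya $C^*$-algebra with fibers $\mathcal{M}_q$ (the $q\times q$ complex matrices). That is, let $\Omega(\mathcal{Z}(\mathcal{A}))$ be the set of nonzero continuous multiplicative linear functionals on the center of $\mathcal{A}$, with the weak$^*$ topology; then $\mathcal{A}$ is a $C^*$-algebra together with a $*$-isomorphism onto the $*$-algebra (with fiberwise operations) of continuous sections of a matrix bundle over $\Omega(\mathcal{Z}(\mathcal{A}))$, i.e. a locally trivial bundle of complex $*$-algebras whose local trivializations are fiberwise $*$-isomorphisms onto $\mathcal{M}_q$. Such an algebra is unital. For $A\in\mathcal{A}$ and $w\in\Omega(\mathcal{Z}(\mathcal{A}))$ let $A(w)$ be the value at $w$ of the section corresponding to $A$, regarded as a $q\times q$ matrix through a $*$-isomorphism of the fiber over $w$ with $\mathcal{M}_q$ given by a local trivialization. A representation is a unital $*$-homomorphism into the bounded operators of a complex Hilbert space $H$; it is irreducible if $H\ne 0$ and $0$ and $H$ are the only closed invariant subspaces. Then: 1. For every $w\in\Omega(\mathcal{Z}(\mathcal{A}))$ the map $A\mapsto A(w)$ is an irreducible representation of $\mathcal{A}$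 on $\mathbb{C}^q$, and every irreducible representation of $\mathcal{A}$ is unitarily equivalent to $A\mapsto A(w)$ for some $w\in\Omega(\mathcal{Z}(\mathcal{A}))$. 2. For every $A\in\mathcal{A}$, $$\sigma(A)=\bigcup_{w\in\Omega(\mathcal{Z}(\mathcal{A}))}\mathrm{eig}\big(A(w)\big),$$ where $\mathrm{eig}$ denotes the set of eigenvalues of a matrix. 3. If $\Omega(\mathcal{Z}(\mathcal{A}))$ is connected, then for every $A\in\mathcal{A}$ the spectrum $\sigma(A)$ is a union of at most $q$ pairwise disjoint connected subsets of $\mathbb{C}$, and if $A$ is unitary then $\sigma(A)$ is a union of at most $q$ pairwise disjoint closed arcs of the unit circle (a single point and the whole circle count as arcs). -/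

import Mathlib

universe u v

section

open Bundle Topology

/-- A matrix bundle over `X`: a bundle of complex `*`-algebras that is locally trivial, with local
trivialisations that are fibrewise `*`-isomorphisms onto the algebra of `q × q` complex matrices. -/
structure MatrixBundle (q : ℕ) (X : Type u) [TopologicalSpace X] where
  /-- the fibre over a point -/
  Fiber : X → Type v
  [ring : ∀ x, Ring (Fiber x)]
  [algebra : ∀ x, Algebra ℂ (Fiber x)]
  [starRing : ∀ x, StarRing (Fiber x)]
  [starModule : ∀ x, StarModule ℂ (Fiber x)]
  [topFiber : ∀ x, TopologicalSpace (Fiber x)]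
  [topTotal : TopologicalSpace (TotalSpace (Matrix (Fin q) (Fin q) ℂ) Fiber)]
  [fiberBundle : FiberBundle (Matrix (Fin q) (Fin q) ℂ) Fiber]
  isStarAlgEquiv : ∀ e ∈ trivializationAtlas (Matrix (Fin q) (Fin q) ℂ) Fiber, ∀ x ∈ e.baseSet,
    ∃ φ : Fiber x ≃⋆ₐ[ℂ] Matrix (Fin q) (Fin q) ℂ, ∀ y : Fiber x, φ y = (e ⟨x, y⟩).2

namespace MatrixBundle

attribute [instance] ring algebra starRing starModule topFiber topTotal fiberBundle

variable {q : ℕ} {X : Type u} [TopologicalSpace X] (E : MatrixBundle.{u, v} q X)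

/-- The identification of the fibre over `x` with the `q × q` matrices that is given by the chosen
local trivialisation around `x`. -/
noncomputable def fiberIso (x : X) : E.Fiber x ≃⋆ₐ[ℂ] Matrix (Fin q) (Fin q) ℂ :=
  (E.isStarAlgEquiv _ (trivialization_mem_atlas _ _ x) x
    (mem_baseSet_trivializationAt _ _ x)).choose

/-- A section of the bundle is continuous as a map into the total space. -/
def IsContinuousSection (s : ∀ x, E.Fiber x) : Prop :=
  Continuous fun x => TotalSpace.mk' (Matrix (Fin q) (Fin q) ℂ) x (s x)

theorem exists_local (x₀ : X) : ∃ φ : ∀ x, E.Fiber x → Matrix (Fin q) (Fin q) ℂ,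
    (∀ s : ∀ x, E.Fiber x,
      ContinuousAt (fun x => TotalSpace.mk' (Matrix (Fin q) (Fin q) ℂ) x (s x)) x₀ ↔
        ContinuousAt (fun x => φ x (s x)) x₀) ∧
    ∀ᶠ x in 𝓝 x₀, ∃ ψ : E.Fiber x ≃⋆ₐ[ℂ] Matrix (Fin q) (Fin q) ℂ, ∀ y, ψ y = φ x y := by
  refine ⟨fun x y => (trivializationAt (Matrix (Fin q) (Fin q) ℂ) E.Fiber x₀ ⟨x, y⟩).2,
    fun s => FiberBundle.continuousAt_section _ x₀, ?_⟩
  filter_upwards [(trivializationAt (Matrix (Fin q) (Fin q) ℂ) E.Fiber x₀).open_baseSet.mem_nhds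
    (mem_baseSet_trivializationAt _ _ x₀)] with x hx
  exact E.isStarAlgEquiv _ (trivialization_mem_atlas _ _ x₀) x hx

/-- The `*`-algebra of continuous sections, with fibrewise operations. -/
def sections : StarSubalgebra ℂ (∀ x, E.Fiber x) where
  carrier := {s | E.IsContinuousSection s}
  mul_mem' := by
    intro s t hs ht
    refine continuous_iff_continuousAt.2 fun x₀ => ?_
    obtain ⟨φ, h, hφ⟩ := E.exists_local x₀
    refine (h _).2 ((((h s).1 hs.continuousAt).mul ((h t).1 ht.continuousAt)).congr ?_)
    filter_upwards [hφ] with x ⟨ψ, hψ⟩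
    simp [← hψ]
  add_mem' := by
    intro s t hs ht
    refine continuous_iff_continuousAt.2 fun x₀ => ?_
    obtain ⟨φ, h, hφ⟩ := E.exists_local x₀
    refine (h _).2 ((((h s).1 hs.continuousAt).add ((h t).1 ht.continuousAt)).congr ?_)
    filter_upwards [hφ] with x ⟨ψ, hψ⟩
    simp [← hψ]
  algebraMap_mem' := by
    intro r
    refine continuous_iff_continuousAt.2 fun x₀ => ?_
    obtain ⟨φ, h, hφ⟩ := E.exists_local x₀
    refine (h _).2 ((continuousAt_const
      (y := algebraMap ℂ (Matrix (Fin q) (Fin q) ℂ) r)).congr ?_)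
    filter_upwards [hφ] with x ⟨ψ, hψ⟩
    rw [← hψ]
    exact (AlgHomClass.commutes ψ r).symm
  star_mem' := by
    intro s hs
    refine continuous_iff_continuousAt.2 fun x₀ => ?_
    obtain ⟨φ, h, hφ⟩ := E.exists_local x₀
    refine (h _).2 (((h s).1 hs.continuousAt).star.congr ?_)
    filter_upwards [hφ] with x ⟨ψ, hψ⟩
    simp [← hψ, map_star]

end MatrixBundle

end

/-- The spectrum `Ω(Z(A))` of the center: the space of nonzero continuous multiplicative linear
functionals on the center, with the weak-`*` topology. -/
abbrev CenterSpectrum (A : Type*) [CStarAlgebra A] : Type _ :=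
  WeakDual.characterSpace ℂ (Subalgebra.center ℂ A)

/-- The structure of an Azumaya `C*`-algebra with fibres isomorphic to the `q × q` matrices:
an identification of `A` with the continuous sections of a matrix bundle over `Ω(Z(A))`. -/
structure AzumayaStructure (A : Type u) [CStarAlgebra A] (q : ℕ) where
  bundle : MatrixBundle.{u, v} q (CenterSpectrum A)
  iso : A ≃⋆ₐ[ℂ] bundle.sections

/-- A representation of `A` on `H` (a unital `*`-homomorphism to the bounded operators) is
irreducible if `H ≠ 0` and the only closed invariant subspaces are `0` and `H`. -/
def IsIrreducibleRep {A H : Type*} [CStarAlgebra A] [NormedAddCommGroup H]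
    [InnerProductSpace ℂ H] [CompleteSpace H] (ρ : A →⋆ₐ[ℂ] (H →L[ℂ] H)) : Prop :=
  Nontrivial H ∧ ∀ K : Submodule ℂ H, IsClosed (K : Set H) →
    (∀ a : A, ∀ x ∈ K, ρ a x ∈ K) → K = ⊥ ∨ K = ⊤

/-- Unitary equivalence of representations. -/
def UnitarilyEquivalentRep {A H₁ H₂ : Type*} [CStarAlgebra A]
    [NormedAddCommGroup H₁] [InnerProductSpace ℂ H₁] [CompleteSpace H₁]
    [NormedAddCommGroup H₂] [InnerProductSpace ℂ H₂] [CompleteSpace H₂]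
    (ρ₁ : A →⋆ₐ[ℂ] (H₁ →L[ℂ] H₁)) (ρ₂ : A →⋆ₐ[ℂ] (H₂ →L[ℂ] H₂)) : Prop :=
  ∃ U : H₁ ≃ₗᵢ[ℂ] H₂, ∀ (a : A) (x : H₁), U (ρ₁ a x) = ρ₂ a (U x)

namespace AzumayaStructure

variable {A : Type u} [CStarAlgebra A] {q : ℕ} (P : AzumayaStructure.{u, v} A q)

/-- The value `a(w)` in the fibre over `w` of the section identified with `a`. -/
noncomputable def value (a : A) (w : CenterSpectrum A) : P.bundle.Fiber w :=
  (P.iso a : ∀ w, P.bundle.Fiber w) w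

/-- The value `a(w)` as a `q × q` matrix. -/
noncomputable def matrixValue (a : A) (w : CenterSpectrum A) : Matrix (Fin q) (Fin q) ℂ :=
  P.bundle.fiberIso w (P.value a w)

/-- The representation `a ↦ a(w)` of `A` on the Hilbert space `ℂ^q`. -/
noncomputable def evalRep (w : CenterSpectrum A) :
    A →⋆ₐ[ℂ] (EuclideanSpace ℂ (Fin q) →L[ℂ] EuclideanSpace ℂ (Fin q)) where
  toFun a := Matrix.toEuclideanCLM (n := Fin q) (𝕜 := ℂ) (P.matrixValue a w)
  map_one' := by simp [matrixValue, value]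
  map_mul' a b := by simp [matrixValue, value]
  map_zero' := by simp [matrixValue, value]
  map_add' a b := by simp [matrixValue, value]
  commutes' r := by
    have h : P.matrixValue (algebraMap ℂ A r) w = algebraMap ℂ _ r := by
      simp only [Algebra.algebraMap_eq_smul_one]
      simp [matrixValue, value]
    rw [h]
    exact AlgHomClass.commutes (Matrix.toEuclideanCLM (n := Fin q) (𝕜 := ℂ)) r
  map_star' a := by simp [matrixValue, value, map_star]

end AzumayaStructure

/-- The set of eigenvalues of a complex matrix. -/
def matrixEig {q : ℕ} (M : Matrix (Fin q) (Fin q) ℂ) : Set ℂ :=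
  {μ | Module.End.HasEigenvalue (Matrix.toLin' M) μ}

/-- A closed arc of the unit circle; a single point and the whole circle are allowed. -/
def IsCircleArc (S : Set ℂ) : Prop :=
  ∃ a b : ℝ, a ≤ b ∧ b ≤ a + 2 * Real.pi ∧
    S = (fun t : ℝ => Complex.exp (t * Complex.I)) '' Set.Icc a b

/-! Everything takes place in the algebra of continuous sections over the compact Hausdorff space X
= Ω(Z(A)).

Representations: scalar functions are central, so in an irreducible representation the kernel of
each is a closed invariant subspace, hence trivial. Thus C(X) acts through evaluation at one point
x₀ (`exists_forall_map_scalarHom_eq`). Matrix units cut off near x₀ (`exists_frame`) then show that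
the whole representation factors through the fibre at x₀, and their images build an orthonormal
basis with q vectors.

Spectrum: a section is invertible once all its values are, because matrix inversion is continuous.

Components: the points whose eigenvalues meet a given clopen piece of the spectrum form a clopen
set. Over a connected base every fibre therefore meets every piece, and a fibre has at most q
eigenvalues. A finest clopen partition has connected pieces; on the unit circle, compact connected
pieces are arcs. -/

open Topology Bundle

/-! ### Matrix bundles: local frames, evaluation and invertibility -/

namespace MatrixBundle

variable {q : ℕ} {X : Type u} [TopologicalSpace X] (E : MatrixBundle.{u, v} q X)

theorem fiberIso_apply (x : X) (y : E.Fiber x) : E.fiberIso x y =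
    (trivializationAt (Matrix (Fin q) (Fin q) ℂ) E.Fiber x ⟨x, y⟩).2 :=
  (E.isStarAlgEquiv _ (trivialization_mem_atlas _ _ x) x
    (mem_baseSet_trivializationAt _ _ x)).choose_spec y

/-- Unlike in `exists_local`, one trivialisation tests continuity at every point of U, as needed to
glue local data into global sections. -/
theorem exists_trivialization (x₀ : X) :
    ∃ (U : Set X) (φ : ∀ x, E.Fiber x → Matrix (Fin q) (Fin q) ℂ), IsOpen U ∧ x₀ ∈ U ∧
      (∀ y, φ x₀ y = E.fiberIso x₀ y) ∧
      (∀ x ∈ U, ∀ s : ∀ x, E.Fiber x,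
        ContinuousAt (fun x => TotalSpace.mk' (Matrix (Fin q) (Fin q) ℂ) x (s x)) x ↔
          ContinuousAt (fun x => φ x (s x)) x) ∧
      ∀ x ∈ U, ∃ ψ : E.Fiber x ≃⋆ₐ[ℂ] Matrix (Fin q) (Fin q) ℂ, ∀ y, ψ y = φ x y := by
  set e := trivializationAt (Matrix (Fin q) (Fin q) ℂ) E.Fiber x₀ with he
  refine ⟨e.baseSet, fun x y => (e ⟨x, y⟩).2, e.open_baseSet, mem_baseSet_trivializationAt _ _ x₀,
    fun y => (E.fiberIso_apply x₀ y).symm, fun x hx s => ?_, fun x hx =>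
    E.isStarAlgEquiv _ (trivialization_mem_atlas _ _ x₀) x hx⟩
  have hs : TotalSpace.mk' (Matrix (Fin q) (Fin q) ℂ) x (s x) ∈ e.source := by
    rwa [e.mem_source]
  rw [ContinuousAt, e.tendsto_nhds_iff hs]
  exact ⟨fun h => h.2, fun h => ⟨Filter.tendsto_id, h⟩⟩

theorem isContinuousSection_of_continuousAt (s : ∀ x, E.Fiber x)
    (h : ∀ x₀, ContinuousAt (fun x => TotalSpace.mk' (Matrix (Fin q) (Fin q) ℂ) x (s x)) x₀) :
    E.IsContinuousSection s :=
  continuous_iff_continuousAt.2 h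

/-- The section `f · 1` given by a scalar function `f`. -/
noncomputable def scalarSection (f : C(X, ℂ)) : E.sections :=
  ⟨fun x => f x • 1, by
    refine continuous_iff_continuousAt.2 fun x₀ => ?_
    obtain ⟨φ, h, hφ⟩ := E.exists_local x₀
    refine (h _).2 (ContinuousAt.congr
      (f := fun x => f x • (1 : Matrix (Fin q) (Fin q) ℂ)) (by fun_prop) ?_)
    filter_upwards [hφ] with x ⟨ψ, hψ⟩
    simp [← hψ]⟩

@[simp] theorem scalarSection_apply (f : C(X, ℂ)) (x : X) :
    (E.scalarSection f : ∀ x, E.Fiber x) x = f x • 1 := rfl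

/-- Scalar functions form a `*`-algebra of sections. -/
noncomputable def scalarHom : C(X, ℂ) →⋆ₐ[ℂ] E.sections where
  toFun := E.scalarSection
  map_one' := by ext x; simp
  map_mul' f g := by ext x; simp [smul_smul, mul_comm]
  map_zero' := by ext x; simp
  map_add' f g := by ext x; simp [add_smul]
  commutes' r := by
    ext x
    simp [Algebra.algebraMap_eq_smul_one]
  map_star' f := by ext x; simp

@[simp] theorem scalarHom_apply (f : C(X, ℂ)) (x : X) :
    (E.scalarHom f : ∀ x, E.Fiber x) x = f x • 1 := rfl

theorem scalarHom_commute (f : C(X, ℂ)) (s : E.sections) : Commute (E.scalarHom f) s := by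
  ext x; simp

/-- Local matrix units times a bump function h extend by zero to global sections. The factor h ^ 2
arises because both the units and the coefficients of s must be cut off; it becomes 1 at x₀. -/
theorem exists_frame [CompactSpace X] [T2Space X] (x₀ : X) :
    ∃ (h : C(X, ℂ)) (e : Fin q → Fin q → E.sections), h x₀ = 1 ∧
      (∀ i j, E.fiberIso x₀ ((e i j : ∀ x, E.Fiber x) x₀) = Matrix.single i j 1) ∧
      ∀ s : E.sections, ∃ c : Fin q → Fin q → C(X, ℂ),
        (∀ i j, c i j x₀ = E.fiberIso x₀ ((s : ∀ x, E.Fiber x) x₀) i j) ∧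
        E.scalarHom (h ^ 2) * s = ∑ i, ∑ j, E.scalarHom (c i j) * e i j := by
  classical
  obtain ⟨U, φ, hU, hx₀, hφ₀, hc, hψ⟩ := E.exists_trivialization x₀
  obtain ⟨V, hVo, hxV, hVU⟩ := exists_open_between_and_isCompact_closure
    (isCompact_singleton (x := x₀)) hU (Set.singleton_subset_iff.2 hx₀)
  obtain ⟨g, hg0, hg1, -⟩ := exists_continuous_zero_one_of_isCompact'
    (isCompact_singleton (x := x₀)) (isClosed_compl_iff.2 hVo)
    (Set.disjoint_compl_right_iff_subset.2 hxV)
  -- Since the closure of V lies in U, continuity can be checked either in the trivialisation or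
  -- where the cut-off vanishes identically.
  have hcov : ∀ x, x ∈ U ∨ ∀ᶠ y in 𝓝 x, g y = 0 := by
    intro x
    by_cases hx : x ∈ closure V
    · exact Or.inl (hVU.1 hx)
    · right
      filter_upwards [isClosed_closure.isOpen_compl.mem_nhds hx] with y hy
      exact hg0 (fun h => hy (subset_closure h))
  have hz : ∀ x, x ∉ U → g x = 0 := fun x hx => ((hcov x).resolve_left hx).self_of_nhds
  let h : C(X, ℂ) := ⟨fun x => (g x : ℂ), by fun_prop⟩
  have hh : ∀ x, h x = (g x : ℂ) := fun _ => rfl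
  choose ψ hψ using hψ
  let e' : Fin q → Fin q → ∀ x, E.Fiber x := fun i j x =>
    if hx : x ∈ U then (ψ x hx).symm (h x • Matrix.single i j 1) else 0
  have he' : ∀ i j, E.IsContinuousSection (e' i j) := by
    intro i j
    refine E.isContinuousSection_of_continuousAt _ fun x => ?_
    rcases hcov x with hx | hx
    · refine (hc x hx _).2 (ContinuousAt.congr
        (f := fun x => h x • (Matrix.single i j 1 : Matrix (Fin q) (Fin q) ℂ)) (by fun_prop) ?_)
      filter_upwards [hU.mem_nhds hx] with y hy
      rw [← hψ y hy]
      simp [e', hy]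
    · have h0 : ContinuousAt (fun x => TotalSpace.mk' (Matrix (Fin q) (Fin q) ℂ) x
          (((0 : E.sections) : ∀ x, E.Fiber x) x)) x := (0 : E.sections).2.continuousAt
      refine h0.congr ?_
      filter_upwards [hx] with y hy
      by_cases hyU : y ∈ U <;> simp [e', hyU, hh, hy]
  have hone : h x₀ = 1 := by
    have := hg1 (Set.mem_singleton x₀)
    simp only [Pi.one_apply] at this
    simp [hh, this]
  refine ⟨h, fun i j => ⟨e' i j, he' i j⟩, hone, fun i j => ?_, fun s => ?_⟩
  · rw [← hφ₀, ← hψ x₀ hx₀]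
    simp [e', hx₀, hone]
  · have hcs : ∀ i j, Continuous fun x => h x * φ x ((s : ∀ x, E.Fiber x) x) i j := by
      intro i j
      refine continuous_iff_continuousAt.2 fun x => ?_
      rcases hcov x with hx | hx
      · have := (hc x hx (s : ∀ x, E.Fiber x)).1 s.2.continuousAt
        have h2 : ContinuousAt (fun x => φ x ((s : ∀ x, E.Fiber x) x) i j) x :=
          ContinuousAt.comp (g := fun M : Matrix (Fin q) (Fin q) ℂ => M i j)
            (continuous_id.matrix_elem i j).continuousAt this
        exact h.continuous.continuousAt.mul h2
      · refine (continuousAt_const (y := (0 : ℂ))).congr ?_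
        filter_upwards [hx] with y hy
        simp [hh, hy]
    refine ⟨fun i j => ⟨_, hcs i j⟩, fun i j => ?_, ?_⟩
    · simp [hone, hφ₀]
    · ext x
      have hsum : ((∑ i, ∑ j, E.scalarHom ⟨_, hcs i j⟩ * ⟨e' i j, he' i j⟩ : E.sections) :
          ∀ x, E.Fiber x) x =
          ∑ i, ∑ j, (h x * φ x ((s : ∀ x, E.Fiber x) x) i j) • e' i j x := by
        simp only [AddSubmonoidClass.coe_finsetSum, Finset.sum_apply]
        simp
      rw [hsum]
      by_cases hx : x ∈ U
      · refine (ψ x hx).injective (show ψ x hx _ = ψ x hx _ from ?_)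
        simp only [MulMemClass.coe_mul, Pi.mul_apply, scalarHom_apply, map_sum, map_smul, e', hx,
          dif_pos, StarAlgEquiv.apply_symm_apply, smul_smul, ← hψ x hx, smul_mul_assoc, one_mul]
        conv_lhs => rw [Matrix.matrix_eq_sum_single (ψ x hx ((s : ∀ x, E.Fiber x) x))]
        simp only [Finset.smul_sum]
        refine Finset.sum_congr rfl fun i _ => Finset.sum_congr rfl fun j _ => ?_
        simp only [Matrix.smul_single, smul_eq_mul, mul_one, ContinuousMap.pow_apply]
        congr 1
        ring
      · simp [e', hx, hh, hz x hx]

/-- The algebra homomorphism evaluating a section at a point, as a matrix. -/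
noncomputable def evalHom (x : X) : E.sections →⋆ₐ[ℂ] Matrix (Fin q) (Fin q) ℂ where
  toFun s := E.fiberIso x ((s : ∀ x, E.Fiber x) x)
  map_one' := by simp
  map_mul' s t := by simp
  map_zero' := by simp
  map_add' s t := by simp
  commutes' r := by
    simp only [Algebra.algebraMap_eq_smul_one]
    simp
  map_star' s := by simp [map_star]

theorem evalHom_apply (x : X) (s : E.sections) :
    E.evalHom x s = E.fiberIso x ((s : ∀ x, E.Fiber x) x) := rfl

theorem evalHom_surjective [CompactSpace X] [T2Space X] (x : X) :
    Function.Surjective (E.evalHom x) := by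
  intro M
  obtain ⟨-, e, -, he, -⟩ := E.exists_frame x
  refine ⟨∑ i, ∑ j, M i j • e i j, ?_⟩
  conv_rhs => rw [Matrix.matrix_eq_sum_single M]
  simp only [map_sum, map_smul, evalHom_apply, he, Matrix.smul_single, smul_eq_mul, mul_one]

/-- In a trivialisation the fibrewise inverse is the matrix inverse, which is continuous where the
determinant is nonzero. -/
theorem isUnit_of_forall_isUnit (s : E.sections) (h : ∀ x, IsUnit (E.evalHom x s)) :
    IsUnit s := by
  have hf : ∀ x, IsUnit ((s : ∀ x, E.Fiber x) x) := fun x =>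
    (isUnit_map_iff (E.fiberIso x) _).1 (h x)
  have hcont : E.IsContinuousSection fun x => (↑(hf x).unit⁻¹ : E.Fiber x) := by
    refine continuous_iff_continuousAt.2 fun x₀ => ?_
    obtain ⟨φ, hc, hφ⟩ := E.exists_local x₀
    refine (hc _).2 ?_
    have hev : ∀ᶠ x in 𝓝 x₀, (φ x ((s : ∀ x, E.Fiber x) x))⁻¹ = φ x (↑(hf x).unit⁻¹) := by
      filter_upwards [hφ] with x ⟨ψ, hψ⟩
      refine Matrix.inv_eq_left_inv ?_
      rw [← hψ, ← hψ, ← map_mul, IsUnit.val_inv_mul, map_one]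
    refine ContinuousAt.congr ?_ hev
    have hu : IsUnit (φ x₀ ((s : ∀ x, E.Fiber x) x₀)) := by
      obtain ⟨ψ, hψ⟩ := hφ.self_of_nhds
      rw [← hψ]
      exact (hf x₀).map ψ
    refine ContinuousAt.comp (f := fun x => φ x ((s : ∀ x, E.Fiber x) x))
      (g := fun M => M⁻¹) (continuousAt_matrix_inv _ ?_)
      ((hc _).1 s.2.continuousAt)
    rw [Matrix.isUnit_iff_isUnit_det] at hu
    obtain ⟨d, hd⟩ := hu
    rw [← hd, Ring.inverse_eq_inv']
    exact continuousAt_inv₀ d.ne_zero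
  exact ⟨⟨s, ⟨_, hcont⟩, by ext x; simp, by ext x; simp⟩, rfl⟩

theorem spectrum_eq_iUnion (s : E.sections) :
    spectrum ℂ s = ⋃ x, spectrum ℂ (E.evalHom x s) := by
  ext z
  simp only [Set.mem_iUnion, spectrum.mem_iff]
  constructor
  · intro hz
    by_contra! hcon
    refine hz (E.isUnit_of_forall_isUnit _ fun x => ?_)
    rw [map_sub, AlgHomClass.commutes]
    exact hcon x
  · rintro ⟨x, hx⟩ hz
    apply hx
    have := hz.map (E.evalHom x)
    rwa [map_sub, AlgHomClass.commutes] at this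

end MatrixBundle

/-! ### Clopen partitions, arcs of the circle, and a root estimate -/

theorem exists_continuous_fin_preconnected_fibers {K : Type*} [TopologicalSpace K] (q : ℕ)
    (h : ∀ (n : ℕ) (f : K → Fin n), Continuous f → Function.Surjective f → n ≤ q) :
    ∃ n ≤ q, ∃ f : K → Fin n, Continuous f ∧ Function.Surjective f ∧
      ∀ i, IsPreconnected (f ⁻¹' {i}) := by
  classical
  let p : ℕ → Prop := fun n => ∃ f : K → Fin n, Continuous f ∧ Function.Surjective f
  have hex : ∃ n, p n := by
    rcases isEmpty_or_nonempty K with hK | hK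
    · exact ⟨0, isEmptyElim, continuous_of_const fun x => isEmptyElim x, fun i => i.elim0⟩
    · exact ⟨1, fun _ => 0, continuous_const, fun i => ⟨Classical.arbitrary K, Subsingleton.elim _ _⟩⟩
  obtain ⟨m, f₀, hm⟩ := hex
  -- With n maximal, splitting a fibre of f would produce a surjection onto `Fin (n + 1)`.
  have hmax : p (Nat.findGreatest p q) := Nat.findGreatest_spec (h m f₀ hm.1 hm.2) ⟨f₀, hm⟩
  set n := Nat.findGreatest p q with hn
  obtain ⟨f, hf, hfs⟩ := hmax
  refine ⟨n, h n f hf hfs, f, hf, hfs, fun i => ?_⟩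
  have hF : IsClopen (f ⁻¹' {i}) := (isClopen_discrete {i}).preimage hf
  rw [isPreconnected_iff_subset_of_fully_disjoint_closed hF.1]
  intro u v hu hv huv hd
  by_contra! hcon
  obtain ⟨⟨a, ha, hau⟩, ⟨b, hb, hbv⟩⟩ := hcon.imp Set.not_subset.1 Set.not_subset.1
  have hD : IsClopen (f ⁻¹' {i} ∩ u) := by
    refine ⟨hF.1.inter hu, ?_⟩
    have : f ⁻¹' {i} ∩ u = f ⁻¹' {i} ∩ vᶜ := by
      ext x
      constructor
      · exact fun hx => ⟨hx.1, Set.disjoint_left.1 hd hx.2⟩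
      · exact fun hx => ⟨hx.1, (huv hx.1).resolve_right hx.2⟩
    rw [this]
    exact hF.2.inter hv.isOpen_compl
  -- The piece inside u gets the new value `Fin.last n`, attained at b; the point a, outside u,
  -- keeps the old value i attained.
  have hsucc : p (n + 1) := by
    refine ⟨fun x => if x ∈ f ⁻¹' {i} ∩ u then Fin.last n else (f x).castSucc,
      continuous_const.if (fun x hx => ?_) (continuous_of_discreteTopology.comp hf), fun j => ?_⟩
    · have : x ∈ frontier (f ⁻¹' {i} ∩ u) := hx
      simp [hD.frontier_eq] at this
    · refine Fin.lastCases ?_ (fun j => ?_) j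
      · exact ⟨b, if_pos ⟨hb, (huv hb).resolve_right hbv⟩⟩
      · by_cases hj : j = i
        · refine ⟨a, ?_⟩
          simp only
          rw [if_neg fun hx => hau hx.2, show f a = i from ha, hj]
        · obtain ⟨x, hx⟩ := hfs j
          refine ⟨x, ?_⟩
          simp only
          rw [if_neg fun hx' => hj (hx ▸ hx'.1), hx]
  have hle : n + 1 ≤ n :=
    Nat.le_findGreatest (hsucc.elim fun g hg => h (n + 1) g hg.1 hg.2) hsucc
  omega

theorem isCircleArc_of_isConnected {S : Set ℂ} (hS : S ⊆ Metric.sphere 0 1) (hc : IsConnected S)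
    (hK : IsCompact S) : IsCircleArc S := by
  by_cases hne : Metric.sphere (0 : ℂ) 1 ⊆ S
  · refine ⟨0, 2 * Real.pi, by positivity, by simp, ?_⟩
    rw [hS.antisymm hne]
    ext z
    simp only [mem_sphere_iff_norm, sub_zero, Set.mem_image, Set.mem_Icc]
    constructor
    · intro hz
      refine ⟨toIcoMod Real.two_pi_pos 0 z.arg, ?_, ?_⟩
      · have := toIcoMod_mem_Ico Real.two_pi_pos 0 z.arg
        simp only [zero_add, Set.mem_Ico] at this
        exact ⟨this.1, this.2.le⟩
      · rw [toIcoMod]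
        push_cast
        simp only [zsmul_eq_mul]
        rw [sub_mul, Complex.exp_sub, mul_assoc, Complex.exp_int_mul_two_pi_mul_I, div_one]
        simpa [hz] using Complex.norm_mul_exp_arg_mul_I z
    · rintro ⟨t, -, rfl⟩
      exact Complex.norm_exp_ofReal_mul_I t
  · obtain ⟨p, hp, hpS⟩ := Set.not_subset.1 hne
    have hp1 : ‖p‖ = 1 := by simpa using hp
    have hp0 : p ≠ 0 := by
      rintro rfl
      simp at hp1
    have hz1 : ∀ z ∈ S, ‖z‖ = 1 := fun z hz => by simpa using hS hz
    have hslit : ∀ z ∈ S, -(z / p) ∈ Complex.slitPlane := by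
      intro z hz
      rw [Complex.mem_slitPlane_iff_arg]
      refine ⟨fun harg => hpS ?_, by
        have := hz1 z hz
        simp only [ne_eq, neg_eq_zero, div_eq_zero_iff, hp0, or_false]
        rintro rfl
        simp at this⟩
      have := Complex.norm_mul_exp_arg_mul_I (-(z / p))
      rw [harg, Complex.exp_pi_mul_I, norm_neg, norm_div, hp1, hz1 z hz] at this
      simp only [div_one, Complex.ofReal_one, one_mul] at this
      have hzp : z / p = 1 := neg_injective this.symm
      rw [div_eq_one_iff_eq hp0] at hzp
      exact hzp ▸ hz
    -- Division by -p moves the missing point p to -1, on the branch cut of `arg`; θ undoes this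
    -- rotation. So t is a continuous angle on S with values in a window of length 2π.
    let θ : ℝ := p.arg + Real.pi
    let t : ℂ → ℝ := fun z => (-(z / p)).arg + θ
    have ht : ContinuousOn t S := by
      intro z hz
      refine ContinuousAt.continuousWithinAt ?_
      refine ContinuousAt.add ?_ continuousAt_const
      exact (Complex.continuousAt_arg (hslit z hz)).comp (f := fun z : ℂ => -(z / p)) (by fun_prop)
    have hexp : ∀ z ∈ S, Complex.exp (t z * Complex.I) = z := by
      intro z hz
      have h1 := Complex.norm_mul_exp_arg_mul_I (-(z / p))
      have h2 := Complex.norm_mul_exp_arg_mul_I p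
      rw [norm_neg, norm_div, hp1, hz1 z hz] at h1
      rw [hp1] at h2
      simp only [div_one, Complex.ofReal_one, one_mul] at h1 h2
      simp only [t, θ, Complex.ofReal_add, add_mul, Complex.exp_add, h1, h2,
        Complex.exp_pi_mul_I]
      field_simp
    have hIcc := eq_Icc_of_connected_compact (hc.image t ht) (hK.image_of_continuousOn ht)
    have hne' : (t '' S).Nonempty := hc.nonempty.image t
    have hb : ∀ x ∈ t '' S, θ - Real.pi ≤ x ∧ x ≤ θ + Real.pi := by
      rintro x ⟨z, -, rfl⟩
      have h1 := Complex.neg_pi_lt_arg (-(z / p))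
      have h2 := Complex.arg_le_pi (-(z / p))
      simp only [t]
      constructor <;> linarith
    have hle : sInf (t '' S) ≤ sSup (t '' S) := by
      rw [hIcc] at hne'
      simpa using hne'
    have hl := hb (sInf (t '' S)) (by
      have := Set.left_mem_Icc.2 hle
      rwa [← hIcc] at this)
    have hr := hb (sSup (t '' S)) (by
      have := Set.right_mem_Icc.2 hle
      rwa [← hIcc] at this)
    refine ⟨sInf (t '' S), sSup (t '' S), hle, by linarith, ?_⟩
    rw [← hIcc, Set.image_image]
    ext z
    constructor
    · exact fun hz => ⟨z, hz, hexp z hz⟩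
    · rintro ⟨w, hw, rfl⟩
      simpa only [hexp w hw] using hw

/-- The characteristic polynomial is a product of q factors z - μ. Contrapositively, a small value
at z forces an eigenvalue near z, which is all the continuity of eigenvalues needed below. -/
theorem Matrix.pow_le_norm_eval_charpoly {q : ℕ} (M : Matrix (Fin q) (Fin q) ℂ) (z : ℂ) {ε : ℝ}
    (hε : 0 ≤ ε) (h : ∀ μ ∈ spectrum ℂ M, ε ≤ dist z μ) : ε ^ q ≤ ‖M.charpoly.eval z‖ := by
  have hs : M.charpoly.Splits := IsAlgClosed.splits _
  rw [hs.eval_eq_prod_roots_of_monic M.charpoly_monic]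
  have hcard : M.charpoly.roots.card = q := by
    rw [← hs.natDegree_eq_card_roots, Matrix.charpoly_natDegree_eq_dim, Fintype.card_fin]
  have hroots : ∀ μ ∈ M.charpoly.roots, ε ≤ ‖z - μ‖ := fun μ hμ => by
    rw [← dist_eq_norm]
    exact h μ (Matrix.mem_spectrum_iff_isRoot_charpoly.2 (Polynomial.isRoot_of_mem_roots hμ))
  suffices ∀ R : Multiset ℂ, (∀ μ ∈ R, ε ≤ ‖z - μ‖) →
      ε ^ R.card ≤ ‖(R.map fun μ => z - μ).prod‖ by
    simpa only [hcard] using this M.charpoly.roots hroots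
  intro R hroots
  induction R using Multiset.induction_on with
  | empty => simp
  | cons a R ih =>
    simp only [Multiset.map_cons, Multiset.prod_cons, norm_mul, Multiset.card_cons, pow_succ']
    exact mul_le_mul (hroots a (by simp)) (ih fun μ hμ => hroots μ (by simp [hμ]))
      (by positivity) (norm_nonneg _)

/-! ### Counting the components of the spectrum -/

namespace MatrixBundle

variable {q : ℕ} {X : Type u} [TopologicalSpace X] (E : MatrixBundle.{u, v} q X)

/-- Closed: nonvanishing of the characteristic polynomial on the compact set C persists nearby.
Open: an eigenvalue in C has nearby eigenvalues at neighbouring points; these lie in V, and the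
spectrum inside V is C. -/
theorem isClopen_setOf_spectrum_inter_nonempty (s : E.sections) {C V : Set ℂ} (hC : IsCompact C)
    (hV : IsOpen V) (hCV : spectrum ℂ s ∩ V = C) :
    IsClopen {x | (spectrum ℂ (E.evalHom x s) ∩ C).Nonempty} := by
  have key : ∀ x₀ : X, ∃ M : X → Matrix (Fin q) (Fin q) ℂ, ContinuousAt M x₀ ∧
      ∀ᶠ x in 𝓝 x₀, ∀ z, z ∈ spectrum ℂ (E.evalHom x s) ↔ (M x).charpoly.eval z = 0 := by
    intro x₀
    obtain ⟨φ, hc, hφ⟩ := E.exists_local x₀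
    refine ⟨fun x => φ x ((s : ∀ x, E.Fiber x) x), (hc _).1 s.2.continuousAt, ?_⟩
    filter_upwards [hφ] with x ⟨ψ, hψ⟩ z
    rw [E.evalHom_apply, AlgEquiv.spectrum_eq, ← hψ, ← AlgEquiv.spectrum_eq ψ]
    exact Matrix.mem_spectrum_iff_isRoot_charpoly
  have hdet : ∀ (M : X → Matrix (Fin q) (Fin q) ℂ) (x₀ : X) (z : ℂ), ContinuousAt M x₀ →
      ContinuousAt (fun p : X × ℂ => (M p.1).charpoly.eval p.2) (x₀, z) := by
    intro M x₀ z hM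
    simp only [Matrix.eval_charpoly]
    have h1 : ContinuousAt (fun p : X × ℂ => M p.1) (x₀, z) :=
      ContinuousAt.comp (f := Prod.fst) (g := M) hM continuousAt_fst
    have h2 : Continuous fun p : X × ℂ => Matrix.scalar (Fin q) p.2 := by
      simp only [Matrix.scalar_apply]
      fun_prop
    exact ContinuousAt.comp (g := Matrix.det) (by fun_prop) (h2.continuousAt.sub h1)
  constructor
  · rw [← isOpen_compl_iff, isOpen_iff_mem_nhds]
    intro x₀ hx₀
    obtain ⟨M, hM, hspec⟩ := key x₀
    have : ∀ᶠ x in 𝓝 x₀, ∀ z ∈ C, (M x).charpoly.eval z ≠ 0 := by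
      refine hC.eventually_forall_of_forall_eventually fun z hz => ?_
      refine (hdet M x₀ z hM).eventually_ne fun h0 => hx₀ ⟨z, ?_, hz⟩
      exact (hspec.self_of_nhds z).2 h0
    filter_upwards [this, hspec] with x hx hxs
    rintro ⟨z, hz, hzC⟩
    exact hx z hzC ((hxs z).1 hz)
  · rw [isOpen_iff_mem_nhds]
    rintro x₀ ⟨z, hz, hzC⟩
    obtain ⟨M, hM, hspec⟩ := key x₀
    obtain ⟨ε, hε, hball⟩ := Metric.isOpen_iff.1 hV z (hCV.symm ▸ hzC : z ∈ spectrum ℂ s ∩ V).2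
    have h0 := (hspec.self_of_nhds z).1 hz
    have hcont : ContinuousAt (fun x => ‖(M x).charpoly.eval z‖) x₀ :=
      (ContinuousAt.comp (f := fun x => (x, z)) (hdet M x₀ z hM) (by fun_prop)).norm
    have hlt : ∀ᶠ x in 𝓝 x₀, ‖(M x).charpoly.eval z‖ < ε ^ q :=
      hcont.eventually_lt_const (by simpa [h0] using pow_pos hε q)
    filter_upwards [hlt, hspec] with x hx hxs
    by_contra hcon
    refine hx.not_ge (Matrix.pow_le_norm_eval_charpoly _ _ hε.le fun μ hμ => ?_)
    by_contra! hd
    have hμ' := (hxs μ).2 (Matrix.mem_spectrum_iff_isRoot_charpoly.1 hμ)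
    refine hcon ⟨μ, hμ', hCV ▸ ⟨?_, hball ?_⟩⟩
    · rw [E.spectrum_eq_iUnion]
      exact Set.mem_iUnion.2 ⟨x, hμ'⟩
    · rwa [Metric.mem_ball, dist_comm]

/-- Each fibre of f is a clopen piece of the spectrum, so it is met by the eigenvalues at x₀.
Choosing one per piece gives n distinct roots of a polynomial of degree q. -/
theorem le_of_continuous_surjective [PreconnectedSpace X] (s : E.sections)
    (hs : IsCompact (spectrum ℂ s)) (n : ℕ) (f : spectrum ℂ s → Fin n) (hf : Continuous f)
    (hfs : Function.Surjective f) : n ≤ q := by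
  rcases Nat.eq_zero_or_pos n with rfl | hn
  · exact Nat.zero_le q
  obtain ⟨⟨z₀, hz₀⟩, -⟩ := hfs ⟨0, hn⟩
  rw [E.spectrum_eq_iUnion] at hz₀
  obtain ⟨x₀, -⟩ := Set.mem_iUnion.1 hz₀
  have : CompactSpace (spectrum ℂ s) := isCompact_iff_compactSpace.1 hs
  have hex : ∀ i, ∃ z ∈ spectrum ℂ (E.evalHom x₀ s), ∃ hz : z ∈ spectrum ℂ s, f ⟨z, hz⟩ = i := by
    intro i
    obtain ⟨V, hV, hVf⟩ := isOpen_induced_iff.1 ((isOpen_discrete {i}).preimage hf)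
    have hCV : spectrum ℂ s ∩ V = Subtype.val '' (f ⁻¹' {i}) := by
      rw [← hVf, Subtype.image_preimage_coe]
    have hclopen := E.isClopen_setOf_spectrum_inter_nonempty s
      ((((isClosed_discrete {i}).preimage hf).isCompact).image continuous_subtype_val) hV hCV
    have huniv := hclopen.eq_univ (by
      obtain ⟨⟨z, hz⟩, hzi⟩ := hfs i
      have hz' := hz
      rw [E.spectrum_eq_iUnion] at hz'
      obtain ⟨x, hx⟩ := Set.mem_iUnion.1 hz'
      exact ⟨x, z, hx, ⟨z, hz⟩, hzi, rfl⟩)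
    obtain ⟨z, hz, ⟨z', hz'⟩, hzi, rfl⟩ := huniv.symm ▸ Set.mem_univ x₀
    exact ⟨z', hz, hz', hzi⟩
  choose z hz hzs hzf using hex
  have hinj : Function.Injective z := by
    intro i j hij
    rw [← hzf i, ← hzf j]
    congr 1
    exact Subtype.ext hij
  have hcard : (Finset.univ.image z).card = n := by
    rw [Finset.card_image_of_injective _ hinj, Finset.card_univ, Fintype.card_fin]
  have hsub : (Finset.univ.image z) ⊆ (E.evalHom x₀ s).charpoly.roots.toFinset := by
    intro μ hμ
    obtain ⟨i, -, rfl⟩ := Finset.mem_image.1 hμ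
    rw [Multiset.mem_toFinset, Polynomial.mem_roots (Matrix.charpoly_monic _).ne_zero]
    exact Matrix.mem_spectrum_iff_isRoot_charpoly.1 (hz i)
  calc n = _ := hcard.symm
    _ ≤ _ := Finset.card_le_card hsub
    _ ≤ _ := Multiset.toFinset_card_le _
    _ ≤ _ := Polynomial.card_roots' _
    _ = q := by rw [Matrix.charpoly_natDegree_eq_dim, Fintype.card_fin]

theorem exists_spectrum_eq_iUnion_isConnected [PreconnectedSpace X] (s : E.sections)
    (hs : IsCompact (spectrum ℂ s)) :
    ∃ n ≤ q, ∃ C : Fin n → Set ℂ, (∀ i, IsConnected (C i) ∧ IsCompact (C i)) ∧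
      Pairwise (fun i j => Disjoint (C i) (C j)) ∧ spectrum ℂ s = ⋃ i, C i := by
  obtain ⟨n, hn, f, hf, hfs, hfp⟩ := exists_continuous_fin_preconnected_fibers q
    (E.le_of_continuous_surjective s hs)
  have : CompactSpace (spectrum ℂ s) := isCompact_iff_compactSpace.1 hs
  refine ⟨n, hn, fun i => Subtype.val '' (f ⁻¹' {i}), fun i => ⟨⟨?_, ?_⟩, ?_⟩, ?_, ?_⟩
  · obtain ⟨z, hz⟩ := hfs i
    exact ⟨z, z, hz, rfl⟩
  · exact (hfp i).image _ continuous_subtype_val.continuousOn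
  · exact (((isClosed_discrete {i}).preimage hf).isCompact).image continuous_subtype_val
  · intro i j hij
    refine Set.disjoint_left.2 ?_
    rintro _ ⟨z, hz, rfl⟩ ⟨z', hz', hzz⟩
    obtain rfl := Subtype.ext hzz
    exact hij (hz.symm.trans hz')
  · ext z
    simp

end MatrixBundle

/-! ### Irreducible representations of the section algebra -/

namespace MatrixBundle

variable {q : ℕ} {X : Type u} [TopologicalSpace X] (E : MatrixBundle.{u, v} q X)
variable {H : Type*} [NormedAddCommGroup H] [InnerProductSpace ℂ H] [CompleteSpace H]

/-- A form of Schur's lemma: if f * g = 0, the range of τ g lies in the invariant subspace ker τ f,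
so τ f or τ g vanishes. The closed ideal ker τ is determined by its common zeros; bump functions
exclude two of them, and having none would put 1 in the kernel. -/
theorem exists_forall_map_scalarHom_eq [CompactSpace X] [T2Space X] [Nontrivial H]
    (σ : E.sections →⋆ₐ[ℂ] (H →L[ℂ] H))
    (hσ : ∀ K : Submodule ℂ H, IsClosed (K : Set H) →
      (∀ s, ∀ x ∈ K, σ s x ∈ K) → K = ⊥ ∨ K = ⊤) :
    ∃ x₀ : X, ∀ f : C(X, ℂ), σ (E.scalarHom f) = f x₀ • 1 := by
  let τ : C(X, ℂ) →⋆ₐ[ℂ] (H →L[ℂ] H) := σ.comp E.scalarHom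
  have hτ : Continuous τ := AddMonoidHomClass.continuous_of_bound τ 1 fun f => by
    simpa only [one_mul] using NonUnitalStarAlgHom.norm_apply_le τ f
  have hprime : ∀ f g : C(X, ℂ), f * g = 0 → τ f = 0 ∨ τ g = 0 := by
    intro f g hfg
    have hmul : τ f * τ g = 0 := by rw [← map_mul, hfg, map_zero]
    rcases hσ (LinearMap.ker (τ f : H →ₗ[ℂ] H)) (τ f).isClosed_ker (by
      intro s x hx
      have hcomm : τ f * σ s = σ s * τ f := by
        change σ (E.scalarHom f) * σ s = σ s * σ (E.scalarHom f)
        rw [← map_mul, ← map_mul, (E.scalarHom_commute f s).eq]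
      have hx' : τ f x = 0 := hx
      have := congrArg (fun T : H →L[ℂ] H => T x) hcomm
      simp only [mul_apply_eq_comp, hx', map_zero] at this
      exact this) with h | h
    · right
      ext x
      have : τ g x ∈ LinearMap.ker (τ f : H →ₗ[ℂ] H) :=
        congrArg (fun T : H →L[ℂ] H => T x) hmul
      rw [h] at this
      exact this
    · left
      ext x
      have : x ∈ LinearMap.ker (τ f : H →ₗ[ℂ] H) := h ▸ Submodule.mem_top
      exact this
  let J : Ideal C(X, ℂ) := RingHom.ker (τ : C(X, ℂ) →ₐ[ℂ] (H →L[ℂ] H))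
  have hJ : ∀ f, f ∈ J ↔ τ f = 0 := fun f => Iff.rfl
  have hJc : IsClosed (J : Set C(X, ℂ)) := isClosed_singleton.preimage hτ
  have hJeq := ContinuousMap.idealOfSet_ofIdeal_isClosed hJc
  have hne : ∃ x₀, x₀ ∉ ContinuousMap.setOfIdeal J := by
    by_contra! hall
    have : (1 : C(X, ℂ)) ∈ J := by
      rw [← hJeq, ContinuousMap.mem_idealOfSet]
      exact fun x hx => absurd (hall x) hx
    rw [hJ, map_one] at this
    exact one_ne_zero this
  obtain ⟨x₀, hx₀⟩ := hne
  have huniq : ∀ x, x ∉ ContinuousMap.setOfIdeal J → x = x₀ := by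
    intro x hx
    by_contra hxx
    obtain ⟨U, V, hU, hV, hxU, hxV, hUV⟩ := t2_separation hxx
    have hbump : ∀ (y : X) (W : Set X), IsOpen W → y ∈ W →
        ∃ f : C(X, ℂ), f y = 1 ∧ ∀ z ∉ W, f z = 0 := by
      intro y W hW hy
      obtain ⟨g, hg0, hg1, -⟩ := exists_continuous_zero_one_of_isCompact'
        (isCompact_singleton (x := y)) (isClosed_compl_iff.2 hW)
        (Set.disjoint_compl_right_iff_subset.2 (Set.singleton_subset_iff.2 hy))
      refine ⟨⟨fun x => (g x : ℂ), by fun_prop⟩, ?_, fun z hz => ?_⟩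
      · simpa using hg1 (Set.mem_singleton y)
      · simpa using hg0 hz
    obtain ⟨f, hf1, hf0⟩ := hbump x U hU hxU
    obtain ⟨g, hg1, hg0⟩ := hbump x₀ V hV hxV
    have hfg : f * g = 0 := by
      ext z
      by_cases hz : z ∈ U
      · simp [hg0 z (Set.disjoint_left.1 hUV hz)]
      · simp [hf0 z hz]
    rcases hprime f g hfg with h | h
    · have := ContinuousMap.notMem_setOfIdeal.1 hx ((hJ f).2 h)
      simp [hf1] at this
    · have := ContinuousMap.notMem_setOfIdeal.1 hx₀ ((hJ g).2 h)
      simp [hg1] at this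
  refine ⟨x₀, fun f => ?_⟩
  have hmem : f - algebraMap ℂ C(X, ℂ) (f x₀) ∈ J := by
    rw [← hJeq, ContinuousMap.mem_idealOfSet]
    intro x hx
    rw [huniq x hx]
    simp
  rw [hJ, map_sub, AlgHomClass.commutes, sub_eq_zero, Algebra.algebraMap_eq_smul_one] at hmem
  exact hmem

theorem exists_unitary_of_irreducible [CompactSpace X] [T2Space X] [Nontrivial H]
    (σ : E.sections →⋆ₐ[ℂ] (H →L[ℂ] H))
    (hσ : ∀ K : Submodule ℂ H, IsClosed (K : Set H) →
      (∀ s, ∀ x ∈ K, σ s x ∈ K) → K = ⊥ ∨ K = ⊤) :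
    ∃ (x₀ : X) (U : H ≃ₗᵢ[ℂ] EuclideanSpace ℂ (Fin q)), ∀ (s : E.sections) (x : H),
      U (σ s x) = Matrix.toEuclideanCLM (n := Fin q) (𝕜 := ℂ) (E.evalHom x₀ s) (U x) := by
  classical
  obtain ⟨x₀, hx₀⟩ := E.exists_forall_map_scalarHom_eq σ hσ
  obtain ⟨h, e, hh, he, hs⟩ := E.exists_frame x₀
  have hsum : ∀ s, σ s = ∑ i, ∑ j, E.evalHom x₀ s i j • σ (e i j) := by
    intro s
    obtain ⟨c, hc, hcs⟩ := hs s
    have := congrArg σ hcs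
    simpa only [map_mul, map_sum, hx₀, ContinuousMap.pow_apply, hh, hc, one_pow, one_smul, one_mul,
      smul_mul_assoc, ← E.evalHom_apply] using this
  have he' : ∀ i j, E.evalHom x₀ (e i j) = Matrix.single i j 1 := he
  -- The frame need not satisfy the matrix unit relations globally; it does at x₀, and by this fact
  -- its image under σ does exactly.
  have hext : ∀ s t, E.evalHom x₀ s = E.evalHom x₀ t → σ s = σ t := by
    intro s t hst
    rw [hsum s, hsum t, hst]
  have hmul : ∀ i j l, σ (e i j) * σ (e j l) = σ (e i l) := by
    intro i j l
    rw [← map_mul]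
    apply hext
    rw [map_mul, he', he', he', Matrix.single_mul_single_same, mul_one]
  have hmul_ne : ∀ i j k l, j ≠ k → σ (e i j) * σ (e k l) = 0 := by
    intro i j k l hjk
    rw [← map_mul, ← map_zero σ]
    apply hext
    rw [map_mul, he', he', Matrix.single_mul_single_of_ne _ _ _ _ hjk, map_zero]
  have hstar : ∀ i j, star (σ (e i j)) = σ (e j i) := by
    intro i j
    rw [← map_star]
    apply hext
    rw [map_star, he', he', Matrix.star_eq_conjTranspose, Matrix.conjTranspose_single, star_one]
  have hone : ∃ i, σ (e i i) ≠ 0 := by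
    by_contra! hall
    have hz : ∀ i j, σ (e i j) = 0 := fun i j => by rw [← hmul i i j, hall, zero_mul]
    have := hsum 1
    simp only [map_one, hz, smul_zero, Finset.sum_const_zero] at this
    exact one_ne_zero this
  obtain ⟨k, hk⟩ := hone
  obtain ⟨y, hy⟩ : ∃ y, σ (e k k) y ≠ 0 := by
    by_contra! hall
    exact hk (ContinuousLinearMap.ext hall)
  -- A unit vector in the range of the projection `σ (e k k)`; the k-th column of matrix units
  -- carries it to the orthonormal family w.
  let v : H := ((‖σ (e k k) y‖ : ℂ)⁻¹) • σ (e k k) y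
  have hv1 : ‖v‖ = 1 := by
    simp only [v, norm_smul, norm_inv, Complex.norm_real, norm_norm]
    exact inv_mul_cancel₀ (norm_ne_zero_iff.2 hy)
  have hvk : σ (e k k) v = v := by
    simp only [v, map_smul]
    rw [← mul_apply_eq_comp, hmul]
  let w : Fin q → H := fun i => σ (e i k) v
  have hact : ∀ a i, σ (e a i) (w i) = w a := by
    intro a i
    change σ (e a i) (σ (e i k) v) = _
    rw [← mul_apply_eq_comp, hmul]
  have hact_ne : ∀ a b i, b ≠ i → σ (e a b) (w i) = 0 := by
    intro a b i hbi
    change σ (e a b) (σ (e i k) v) = _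
    rw [← mul_apply_eq_comp, hmul_ne _ _ _ _ hbi, _root_.zero_apply]
  have hw : Orthonormal ℂ w := by
    rw [orthonormal_iff_ite]
    intro i j
    change inner ℂ (σ (e i k) v) (w j) = _
    rw [← ContinuousLinearMap.adjoint_inner_right, ← ContinuousLinearMap.star_eq_adjoint, hstar]
    split_ifs with hij
    · subst hij
      rw [hact]
      change inner ℂ v (σ (e k k) v) = _
      rw [hvk, inner_self_eq_norm_sq_to_K, hv1]
      simp
    · rw [hact_ne _ _ _ hij, inner_zero_right]
  have hsw : ∀ s i, σ s (w i) = ∑ a, E.evalHom x₀ s a i • w a := by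
    intro s i
    rw [hsum s]
    simp only [_root_.sum_apply, _root_.smul_apply]
    refine Finset.sum_congr rfl fun a _ => ?_
    rw [Finset.sum_eq_single i (fun b _ hb => by rw [hact_ne _ _ _ hb, smul_zero]) (by simp), hact]
  -- The span is finite-dimensional, hence closed, and it is invariant and nonzero, so
  -- irreducibility applies.
  have hspan : Submodule.span ℂ (Set.range w) = ⊤ := by
    have : FiniteDimensional ℂ (Submodule.span ℂ (Set.range w)) :=
      FiniteDimensional.span_of_finite ℂ (Set.finite_range w)
    refine (hσ _ (Submodule.closed_of_finiteDimensional _) ?_).resolve_left ?_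
    · intro s x hx
      have hle : Submodule.span ℂ (Set.range w) ≤
          (Submodule.span ℂ (Set.range w)).comap (σ s : H →ₗ[ℂ] H) := by
        rw [Submodule.span_le]
        rintro _ ⟨i, rfl⟩
        change σ s (w i) ∈ Submodule.span ℂ (Set.range w)
        rw [hsw]
        exact Submodule.sum_mem _ fun a _ =>
          Submodule.smul_mem _ _ (Submodule.subset_span ⟨a, rfl⟩)
      exact hle hx
    · intro hbot
      have : w k ∈ Submodule.span ℂ (Set.range w) := Submodule.subset_span ⟨k, rfl⟩
      rw [hbot, Submodule.mem_bot] at this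
      exact hw.ne_zero k this
  let b : OrthonormalBasis (Fin q) ℂ H := OrthonormalBasis.mk hw hspan.ge
  refine ⟨x₀, b.repr, fun s x => ?_⟩
  have hlin : (b.repr.toLinearEquiv : H →ₗ[ℂ] EuclideanSpace ℂ (Fin q)) ∘ₗ (σ s : H →ₗ[ℂ] H) =
      (Matrix.toEuclideanCLM (n := Fin q) (𝕜 := ℂ) (E.evalHom x₀ s) :
        EuclideanSpace ℂ (Fin q) →ₗ[ℂ] EuclideanSpace ℂ (Fin q)) ∘ₗ
        (b.repr.toLinearEquiv : H →ₗ[ℂ] EuclideanSpace ℂ (Fin q)) := by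
    refine b.toBasis.ext fun i => ?_
    have hb : ∀ i, b i = w i := fun i => by simp [b]
    simp only [OrthonormalBasis.coe_toBasis]
    change b.repr (σ s (b i)) = Matrix.toEuclideanCLM (n := Fin q) (𝕜 := ℂ) _ (b.repr (b i))
    rw [hb, hsw, ← hb, b.repr_self]
    simp only [map_sum, map_smul, ← hb, b.repr_self]
    ext a
    simp [Matrix.ofLp_toEuclideanCLM, Pi.single_apply]
  exact congrArg (fun T : H →ₗ[ℂ] EuclideanSpace ℂ (Fin q) => T x) hlin

end MatrixBundle

/-! ### Transfer to the Azumaya algebra -/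

theorem EuclideanSpace.eq_bot_or_eq_top_of_matrix_invariant {q : ℕ}
    (K : Submodule ℂ (EuclideanSpace ℂ (Fin q)))
    (hK : ∀ (M : Matrix (Fin q) (Fin q) ℂ), ∀ x ∈ K,
      Matrix.toEuclideanCLM (n := Fin q) (𝕜 := ℂ) M x ∈ K) : K = ⊥ ∨ K = ⊤ := by
  refine or_iff_not_imp_left.2 fun hbot => ?_
  obtain ⟨x, hx, hx0⟩ := (Submodule.ne_bot_iff K).1 hbot
  obtain ⟨j, hj⟩ : ∃ j, x j ≠ 0 := by
    by_contra! hall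
    exact hx0 (by ext j; simpa using hall j)
  refine (Submodule.eq_top_iff').2 fun y => ?_
  -- This rank-one matrix sends x to the arbitrary vector y.
  have := hK (Matrix.vecMulVec y (Pi.single j (x j)⁻¹)) x hx
  convert this using 1
  ext a
  simp [Matrix.vecMulVec_mulVec, hj]

theorem matrixEig_eq_spectrum {q : ℕ} (M : Matrix (Fin q) (Fin q) ℂ) :
    matrixEig M = spectrum ℂ M := by
  ext μ
  rw [← Matrix.spectrum_toLin']
  exact Module.End.hasEigenvalue_iff_mem_spectrum

namespace AzumayaStructure

variable {A : Type u} [CStarAlgebra A] {q : ℕ} (P : AzumayaStructure.{u, v} A q)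

theorem spectrum_eq_spectrum_iso (a : A) : spectrum ℂ a = spectrum ℂ (P.iso a) :=
  (AlgEquiv.spectrum_eq P.iso a).symm

end AzumayaStructure

/-- Completeness of the center is what makes its character space compact. -/
instance Subalgebra.instCompleteSpaceCenter {A : Type*} [CStarAlgebra A] :
    CompleteSpace (Subalgebra.center ℂ A) :=
  have h : IsClosed (Set.center A) := by
    rw [← Set.centralizer_univ]
    exact Set.isClosed_centralizer _
  h.completeSpace_coe

theorem mainTheorem10 {A : Type u} [CStarAlgebra A] (q : ℕ) (hq : 1 ≤ q)
    (P : AzumayaStructure.{u, v} A q) :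
    ((∀ w : CenterSpectrum A, IsIrreducibleRep (P.evalRep w)) ∧
      ∀ (H : Type*) [NormedAddCommGroup H] [InnerProductSpace ℂ H] [CompleteSpace H]
        (ρ : A →⋆ₐ[ℂ] (H →L[ℂ] H)), IsIrreducibleRep ρ →
          ∃ w : CenterSpectrum A, UnitarilyEquivalentRep ρ (P.evalRep w)) ∧
    (∀ a : A, spectrum ℂ a = ⋃ w : CenterSpectrum A, matrixEig (P.matrixValue a w)) ∧
    (PreconnectedSpace (CenterSpectrum A) →
      (∀ a : A, ∃ n ≤ q, ∃ C : Fin n → Set ℂ, (∀ i, IsConnected (C i)) ∧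
        Pairwise (fun i j => Disjoint (C i) (C j)) ∧ spectrum ℂ a = ⋃ i, C i) ∧
      (∀ a ∈ unitary A, ∃ n ≤ q, ∃ C : Fin n → Set ℂ, (∀ i, IsCircleArc (C i)) ∧
        Pairwise (fun i j => Disjoint (C i) (C j)) ∧ spectrum ℂ a = ⋃ i, C i)) := by
  have : CompactSpace (CenterSpectrum A) := inferInstance
  have : T2Space (CenterSpectrum A) := inferInstance
  have hcpt : ∀ a : A, IsCompact (spectrum ℂ (P.iso a)) := fun a => by
    rw [← P.spectrum_eq_spectrum_iso]
    exact spectrum.isCompact a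
  refine ⟨⟨fun w => ⟨?_, fun K _ hK => ?_⟩, ?_⟩, fun a => ?_, fun hconn => ⟨fun a => ?_,
    fun a ha => ?_⟩⟩
  · have : Nonempty (Fin q) := ⟨⟨0, hq⟩⟩
    infer_instance
  · refine EuclideanSpace.eq_bot_or_eq_top_of_matrix_invariant K fun M x hx => ?_
    obtain ⟨s, rfl⟩ := P.bundle.evalHom_surjective w M
    obtain ⟨a, rfl⟩ := P.iso.surjective s
    exact hK a x hx
  · intro H _ _ _ ρ hρ
    have := hρ.1
    obtain ⟨w, U, hU⟩ := P.bundle.exists_unitary_of_irreducible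
      (ρ.comp (P.iso.symm : P.bundle.sections →⋆ₐ[ℂ] A)) (fun K hc hK => hρ.2 K hc fun a x hx => by
        have := hK (P.iso a) x hx
        simpa using this)
    refine ⟨w, U, fun a x => ?_⟩
    have := hU (P.iso a) x
    simp only [StarAlgHom.comp_apply, StarAlgHom.coe_coe, StarAlgEquiv.symm_apply_apply] at this
    exact this
  · rw [P.spectrum_eq_spectrum_iso, P.bundle.spectrum_eq_iUnion]
    simp only [matrixEig_eq_spectrum]
    rfl
  · obtain ⟨n, hn, C, hC, hd, hU⟩ :=
      P.bundle.exists_spectrum_eq_iUnion_isConnected (P.iso a) (hcpt a)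
    exact ⟨n, hn, C, fun i => (hC i).1, hd, (P.spectrum_eq_spectrum_iso a).trans hU⟩
  · obtain ⟨n, hn, C, hC, hd, hU⟩ :=
      P.bundle.exists_spectrum_eq_iUnion_isConnected (P.iso a) (hcpt a)
    have hsp := (P.spectrum_eq_spectrum_iso a).trans hU
    refine ⟨n, hn, C, fun i => isCircleArc_of_isConnected ?_ (hC i).1 (hC i).2, hd, hsp⟩
    exact (Set.subset_iUnion C i).trans
      (hsp ▸ spectrum.subset_circle_of_unitary ha)
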